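/- Let $d,m_1,m_2>0$ and consider the planar two-center problem with energy $$H=\tfrac12(p_x^2+p_y^2)-\frac{m_1}{\sqrt{(x+d)^2+y^2}}-\frac{m_2}{\sqrt{(x-d)^2+y^2}}$$ and second integral $$G=\tfrac12(xp_y-yp_x)^2+\tfrac12 d^2p_x^2+dx\Big(\frac{m_1}{\sqrt{(x+d)^2+y^2}}-\frac{m_2}{\sqrt{(x-d)^2+y^2}}\Big).$$ Use the regularizing variables $(\lambda,\nu)\in\mathbb R\times\mathbb R/2\pi\mathbb Z$, $x+iy=d\sin(\nu+i\lambda)$, with conjugate momenta $(p_\lambda,p_\nu)$ and the time $\tau$ given by $dt=d^2(\cosh^2\lambda-\sin^2\nu)\,d\tau$. At energy $h$ the regularized flow is the Hamiltonian flow of $H_\lambda+H_\nu$, where $$H_\lambda=\tfrac12p_\lambda^2-d(m_1+m_2)\cosh\lambda-hd^2\cosh^2\lambda,\qquad H_\nu=\tfrac12p_\nu^2+d(m_1-m_2)\sin\nu+hd^2\sin^2\nu,$$ and the inverse image of the value $(g,h)$ of $(G,H)$, expressed in these variables, is $\{H_\lambda=-g,\ H_\nu=g\}\subset T^*(\mathbb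 R\times\mathbb R/2\pi\mathbb Z)$. A regular torus over $(g,h)$ is a compact connected component of this set, where $(g,h)$ is a regular value of $(G,H)$. Collision points are the points with $(x,y)=(\pm d,0)$. Put $\kappa_{++}=hd^2+d(m_1+m_2)$, $\kappa_{-\pm}=hd^2\pm d|m_1-m_2|$, $\chi_-=-(m_1-m_2)^2/(4h)$, $h_\nu=-|m_1-m_2|/(2d)$. For $h<0$ a regular torus over $(g,h)$ is of type S if either $\kappa_{--}<g<\kappa_{-+}$, or $h<h_\nu$ and $\kappa_{-+}<g<\min(\chi_-,\kappa_{++})$; it is of type L if $\kappa_{-+}<g<\kappa_{++}$ and, in case $h<h_\nu$, also $\chi_-<g$. Its rotation number is $W=T_\nu/T_\lambda$, where $T_\lambda$ and $T_\nu$ are the least periods (in $\tau$) of the motions of $(\lambda,p_\lambda)$ and of $(\nu,p_\nu)$ on the torus. Let $\mathbb T$ be a regular torus of type S or of type L whose rotation number $W$ is rational. Then $\mathbb T$ contains exactly two collision-collision orbits, that is, exactly two orbits (as point sets) of the regularized flow on $\mathbb T$ that are at collision points at two different times. Moreover each of these two orbits passes through two distinct collision points of $\mathbb T$. -/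

import Mathlib

noncomputable section

namespace TwoCenter

/-! ## The planar two-center problem in Cartesian coordinates

A unit test particle is attracted by a center of mass `m₁` at `(-d, 0)` and a center of mass `m₂`
at `(d, 0)`. Points of the Cartesian phase space are written `(x, y, p_x, p_y)`. -/

/-- Distance of `(x, y)` to the left center `(-d, 0)`. -/
def distLeft (d x y : ℝ) : ℝ := √((x + d) ^ 2 + y ^ 2)

/-- Distance of `(x, y)` to the right center `(d, 0)`. -/
def distRight (d x y : ℝ) : ℝ := √((x - d) ^ 2 + y ^ 2)

/-- The energy `H`. -/
def energy (d m₁ m₂ x y px py : ℝ) : ℝ :=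
  (px ^ 2 + py ^ 2) / 2 - m₁ / distLeft d x y - m₂ / distRight d x y

/-- Euler's second integral `G`. -/
def secondIntegral (d m₁ m₂ x y px py : ℝ) : ℝ :=
  (x * py - y * px) ^ 2 / 2 + d ^ 2 * px ^ 2 / 2
    + d * x * (m₁ / distLeft d x y - m₂ / distRight d x y)

/-- The integral map `(G, H)`. -/
def integralMap (d m₁ m₂ : ℝ) (z : ℝ × ℝ × ℝ × ℝ) : ℝ × ℝ :=
  (secondIntegral d m₁ m₂ z.1 z.2.1 z.2.2.1 z.2.2.2, energy d m₁ m₂ z.1 z.2.1 z.2.2.1 z.2.2.2)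

/-- `(g, h)` is a regular value of the integral map on the phase space `T*(ℝ² ∖ {(±d, 0)})`. -/
def IsRegularValue (d m₁ m₂ g h : ℝ) : Prop :=
  ∀ z : ℝ × ℝ × ℝ × ℝ, (z.1, z.2.1) ≠ (-d, 0) → (z.1, z.2.1) ≠ (d, 0) →
    integralMap d m₁ m₂ z = (g, h) →
      Function.Surjective (fderiv ℝ (integralMap d m₁ m₂) z)

/-! ## Regularizing variables

`x + i y = d sin (ν + i λ)` with `λ ∈ ℝ` and `ν ∈ ℝ / 2πℤ`, and a new time `τ` with
`dt = d² (cosh² λ - sin² ν) dτ`. -/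

/-- The regularized phase space `T*(ℝ × S¹)`; its points are written `(λ, ν, p_λ, p_ν)`. -/
abbrev PhaseSpace : Type := ℝ × Real.Angle × ℝ × ℝ

/-- The position `(x, y)` of the particle in terms of the regularizing variables. -/
def position (d : ℝ) (z : PhaseSpace) : ℝ × ℝ :=
  (d * (Real.cosh z.1 * z.2.1.sin), d * (Real.sinh z.1 * z.2.1.cos))

/-- The collision points: those over one of the two centers. -/
def collisions (d : ℝ) : Set PhaseSpace :=
  {z | position d z = (-d, 0) ∨ position d z = (d, 0)}

/-- The separated Hamiltonian `H_λ` at energy `h`. -/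
def hamLambda (d m₁ m₂ h q p : ℝ) : ℝ :=
  p ^ 2 / 2 - d * (m₁ + m₂) * Real.cosh q - h * d ^ 2 * Real.cosh q ^ 2

/-- The separated Hamiltonian `H_ν` at energy `h`. -/
def hamNu (d m₁ m₂ h : ℝ) (q : Real.Angle) (p : ℝ) : ℝ :=
  p ^ 2 / 2 + d * (m₁ - m₂) * q.sin + h * d ^ 2 * q.sin ^ 2

/-- The inverse image of `(g, h)` under the integral map, expressed in regularizing variables. -/
def levelSet (d m₁ m₂ g h : ℝ) : Set PhaseSpace :=
  {z | hamLambda d m₁ m₂ h z.1 z.2.2.1 = -g ∧ hamNu d m₁ m₂ h z.2.1 z.2.2.2 = g}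

/-- The point of the regularized phase space with coordinates `(λ, ν)` and Cartesian momentum
`(p_x, p_y)`: the momenta `p_λ`, `p_ν` are those of the cotangent lift of `position`. -/
def ofMomentum (d l : ℝ) (n : Real.Angle) (px py : ℝ) : PhaseSpace :=
  (l, n, d * (px * (Real.sinh l * n.sin) + py * (Real.cosh l * n.cos)),
    d * (px * (Real.cosh l * n.cos) - py * (Real.sinh l * n.sin)))

/-- Hamilton's equations for `H_λ + H_ν` (time `τ`). The angle `ν` is followed by a real lift. -/
def IsTrajectory (d m₁ m₂ h : ℝ) (γ : ℝ → PhaseSpace) : Prop :=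
  ∃ l n pl pn : ℝ → ℝ,
    (∀ τ, γ τ = (l τ, (n τ : Real.Angle), pl τ, pn τ)) ∧
    (∀ τ, HasDerivAt l (deriv (fun p => hamLambda d m₁ m₂ h (l τ) p) (pl τ)) τ) ∧
    (∀ τ, HasDerivAt n (deriv (fun p => hamNu d m₁ m₂ h (n τ) p) (pn τ)) τ) ∧
    (∀ τ, HasDerivAt pl (-deriv (fun q => hamLambda d m₁ m₂ h q (pl τ)) (l τ)) τ) ∧
    (∀ τ, HasDerivAt pn (-deriv (fun q : ℝ => hamNu d m₁ m₂ h q (pn τ)) (n τ)) τ)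

/-! ## Regular tori, their types and rotation numbers -/

/-- `T` is a regular torus over `(g, h)`: a compact connected component of the inverse image of a
regular value of the integral map, expressed in regularizing variables. -/
def IsRegularTorus (d m₁ m₂ g h : ℝ) (T : Set PhaseSpace) : Prop :=
  IsRegularValue d m₁ m₂ g h ∧ IsCompact T ∧
    ∃ z ∈ levelSet d m₁ m₂ g h, T = connectedComponentIn (levelSet d m₁ m₂ g h) z

/-- The critical value `κ₊₊` of `-H_λ`, attained at `λ = 0`. -/
def kappaPP (d m₁ m₂ h : ℝ) : ℝ := h * d ^ 2 + d * (m₁ + m₂)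

/-- The larger critical value `κ₋₊` of `H_ν` on the lines `ν = ± π / 2`. -/
def kappaMP (d m₁ m₂ h : ℝ) : ℝ := h * d ^ 2 + d * |m₁ - m₂|

/-- The smaller critical value `κ₋₋` of `H_ν` on the lines `ν = ± π / 2`. -/
def kappaMM (d m₁ m₂ h : ℝ) : ℝ := h * d ^ 2 - d * |m₁ - m₂|

/-- The critical value `χ₋` of `H_ν`, present for `h < h_ν`. -/
def chiM (m₁ m₂ h : ℝ) : ℝ := -(m₁ - m₂) ^ 2 / (4 * h)

/-- The energy `h_ν` below which `H_ν` has the critical value `χ₋`. -/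
def hNu (d m₁ m₂ : ℝ) : ℝ := -|m₁ - m₂| / (2 * d)

/-- The regular regions of satellite type in the `(g, h)`-plane: the region `S'` (one torus),
given by `κ₋₋ < g < κ₋₊`, and the region `S` (two tori), given by `κ₋₊ < g < min (χ₋, κ₊₊)` and
`h < h_ν`. -/
def IsTypeS (d m₁ m₂ g h : ℝ) : Prop :=
  h < 0 ∧
    ((kappaMM d m₁ m₂ h < g ∧ g < kappaMP d m₁ m₂ h) ∨
      (h < hNu d m₁ m₂ ∧ kappaMP d m₁ m₂ h < g ∧ g < chiM m₁ m₂ h ∧ g < kappaPP d m₁ m₂ h))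

/-- The regular region of lemniscate type in the `(g, h)`-plane: to the right of the critical
curves of `H_ν` and to the left of the line `g = κ₊₊`. -/
def IsTypeL (d m₁ m₂ g h : ℝ) : Prop :=
  h < 0 ∧ kappaMP d m₁ m₂ h < g ∧ (h < hNu d m₁ m₂ → chiM m₁ m₂ h < g) ∧ g < kappaPP d m₁ m₂ h

/-- The period `T_λ` on `T`: the time needed to traverse the projection of `T` to the
`(λ, p_λ)`-plane, that is, the least period of the `λ`-motion on `T`. -/
def periodLambda (d m₁ m₂ h : ℝ) (T : Set PhaseSpace) : ℝ :=
  sInf {P : ℝ | 0 < P ∧ ∀ γ, IsTrajectory d m₁ m₂ h γ → Set.range γ ⊆ T →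
    Function.Periodic (fun τ => ((γ τ).1, (γ τ).2.2.1)) P}

/-- The period `T_ν` on `T`: the time needed to traverse the projection of `T` to the
`(ν, p_ν)`-cylinder, that is, the least period of the `ν`-motion on `T`. -/
def periodNu (d m₁ m₂ h : ℝ) (T : Set PhaseSpace) : ℝ :=
  sInf {P : ℝ | 0 < P ∧ ∀ γ, IsTrajectory d m₁ m₂ h γ → Set.range γ ⊆ T →
    Function.Periodic (fun τ => ((γ τ).2.1, (γ τ).2.2.2)) P}

/-- The rotation number `W = T_ν / T_λ`. -/
def rotationNumber (d m₁ m₂ h : ℝ) (T : Set PhaseSpace) : ℝ :=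
  periodNu d m₁ m₂ h T / periodLambda d m₁ m₂ h T

/-- The collision-collision orbits on `T`: the orbits `O` in `T` (as sets of points) of the
regularized flow that connect two collisions, i.e. that are at collision points at two different
times. -/
def collisionCollisionOrbits (d m₁ m₂ h : ℝ) (T : Set PhaseSpace) : Set (Set PhaseSpace) :=
  {O | ∃ γ, IsTrajectory d m₁ m₂ h γ ∧ Set.range γ = O ∧ O ⊆ T ∧
    ∃ s t : ℝ, s < t ∧ γ s ∈ collisions d ∧ γ t ∈ collisions d}

/-! ## The regularized level sets are those of the integral map -/

theorem distLeft_position {d : ℝ} (hd : 0 < d) (l : ℝ) (n : Real.Angle) (p : ℝ × ℝ) :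
    distLeft d (position d (l, n, p)).1 (position d (l, n, p)).2 =
      d * (Real.cosh l + n.sin) := by
  have h1 : 0 ≤ Real.cosh l + n.sin := by
    have := Real.one_le_cosh l
    have := n.cos_sq_add_sin_sq
    nlinarith [sq_nonneg n.cos, sq_nonneg (n.sin - 1)]
  rw [distLeft, ← Real.sqrt_sq (mul_nonneg hd.le h1)]
  congr 1
  have hc := n.cos_sq_add_sin_sq
  have hh := Real.cosh_sq l
  simp only [position]
  linear_combination (d ^ 2 * Real.sinh l ^ 2) * hc + (d ^ 2 * n.sin ^ 2 - d ^ 2) * hh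

theorem distRight_position {d : ℝ} (hd : 0 < d) (l : ℝ) (n : Real.Angle) (p : ℝ × ℝ) :
    distRight d (position d (l, n, p)).1 (position d (l, n, p)).2 =
      d * (Real.cosh l - n.sin) := by
  have h1 : 0 ≤ Real.cosh l - n.sin := by
    have := Real.one_le_cosh l
    have := n.cos_sq_add_sin_sq
    nlinarith [sq_nonneg n.cos, sq_nonneg (n.sin + 1)]
  rw [distRight, ← Real.sqrt_sq (mul_nonneg hd.le h1)]
  congr 1
  have hc := n.cos_sq_add_sin_sq
  have hh := Real.cosh_sq l
  simp only [position]
  linear_combination (d ^ 2 * Real.sinh l ^ 2) * hc + (d ^ 2 * n.sin ^ 2 - d ^ 2) * hh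

/-- Away from collisions, a point lies on the regularized level set of `(g, h)` if and only if
`G = g` and `H = h` there. -/
theorem ofMomentum_mem_levelSet_iff {d : ℝ} (hd : 0 < d) (m₁ m₂ g h l : ℝ) (n : Real.Angle)
    (px py : ℝ) (hcol : ofMomentum d l n px py ∉ collisions d) :
    ofMomentum d l n px py ∈ levelSet d m₁ m₂ g h ↔
      integralMap d m₁ m₂ ((position d (ofMomentum d l n px py)).1,
        (position d (ofMomentum d l n px py)).2, px, py) = (g, h) := by
  have hc := n.cos_sq_add_sin_sq
  have hh := Real.cosh_sq l
  have h1 := Real.one_le_cosh l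
  have hP : Real.cosh l + n.sin ≠ 0 := fun h0 => hcol <| by
    have e1 : Real.cosh l = 1 := by nlinarith [sq_nonneg n.cos]
    have e2 : n.sin = -1 := by linarith
    have e3 : Real.sinh l = 0 := by rw [e1] at hh; nlinarith
    left
    simp [ofMomentum, position, e1, e2, e3]
  have hM : Real.cosh l - n.sin ≠ 0 := fun h0 => hcol <| by
    have e1 : Real.cosh l = 1 := by nlinarith [sq_nonneg n.cos]
    have e2 : n.sin = 1 := by linarith
    have e3 : Real.sinh l = 0 := by rw [e1] at hh; nlinarith
    right
    simp [ofMomentum, position, e1, e2, e3]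
  have hd' := hd.ne'
  obtain ⟨pl, pn, hpl, hpn, hz⟩ : ∃ pl pn,
      pl = d * (px * (Real.sinh l * n.sin) + py * (Real.cosh l * n.cos)) ∧
      pn = d * (px * (Real.cosh l * n.cos) - py * (Real.sinh l * n.sin)) ∧
      ofMomentum d l n px py = (l, n, pl, pn) := ⟨_, _, rfl, rfl, rfl⟩
  have hL := distLeft_position hd l n (pl, pn)
  have hR := distRight_position hd l n (pl, pn)
  rw [hz]
  simp only [levelSet, Set.mem_ofPred_eq, integralMap, Prod.mk.injEq, energy, secondIntegral, hL, hR]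
  simp only [position, hamLambda, hamNu]
  set c := Real.cosh l
  set S := Real.sinh l
  set s := n.sin
  set k := n.cos
  set H := (px ^ 2 + py ^ 2) / 2 - m₁ / (d * (c + s)) - m₂ / (d * (c - s)) with hH
  set G := (d * (c * s) * py - d * (S * k) * px) ^ 2 / 2 + d ^ 2 * px ^ 2 / 2
    + d * (d * (c * s)) * (m₁ / (d * (c + s)) - m₂ / (d * (c - s))) with hG
  have k2 : k ^ 2 = 1 - s ^ 2 := by linarith
  have S2 : S ^ 2 = c ^ 2 - 1 := by linarith
  have I1 : (pl ^ 2 / 2 - d * (m₁ + m₂) * c - h * d ^ 2 * c ^ 2)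
      + (pn ^ 2 / 2 + d * (m₁ - m₂) * s + h * d ^ 2 * s ^ 2)
      = (H - h) * (d ^ 2 * ((c + s) * (c - s))) := by
    rw [hH, hpl, hpn]
    field_simp
    ring_nf
    simp only [k2, S2]
    ring
  have I2 : pn ^ 2 / 2 + d * (m₁ - m₂) * s + h * d ^ 2 * s ^ 2
      = G + (h - H) * (d ^ 2 * s ^ 2) := by
    rw [hH, hG, hpn]
    field_simp
    ring_nf
    simp only [k2, S2]
    ring
  constructor
  · rintro ⟨a, b⟩
    have : (H - h) * (d ^ 2 * ((c + s) * (c - s))) = 0 := by rw [← I1, a, b]; ring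
    have hHh : H = h := by
      have hne : d ^ 2 * ((c + s) * (c - s)) ≠ 0 := by positivity
      have := (mul_eq_zero.mp this).resolve_right hne
      linarith
    refine ⟨?_, hHh⟩
    rw [I2, hHh] at b
    linarith
  · rintro ⟨a, b⟩
    rw [a, b] at I2
    rw [b] at I1
    constructor <;> linarith

end TwoCenter

end

/-! The Hamiltonian `H_λ + H_ν` separates, so a torus of type S or L is the product of a closed
curve in the `(λ, p_λ)`-plane and a closed curve in the `(ν, p_ν)`-cylinder, and time makes the flow
on it linear with periods `T_λ` and `T_ν`. Collisions are the points with `λ = 0` and `cos ν = 0`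
(`mem_collisions_iff`). Each factor motion, started on its own condition, meets it again exactly at
the multiples of its half period, so the collisions on the torus form the grid of half periods: four
points.

If `T_ν / T_λ = p / q` in lowest terms, write `T_λ = 2qw`, `T_ν = 2pw`. Orbits correspond to phase
differences modulo `2w`, while the grid realizes precisely the phase differences in `wℤ`; hence two
orbits. After time `pqw` a collision is carried to a collision, and to a different one because `p`
and `q` are not both even. This is `encard_orbits_through_half_periods`.

The factor motions come from explicit parametrizations of the level curves by an angle `φ` with `φ'
= ω(φ)`, where `ω` is positive, even and `2π`-periodic: `exists_motion_lambda`,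
`exists_motion_nu_libration` (type S), `exists_motion_nu_rotation` (type L).
`connectedComponentIn_levelSet_eq` identifies the torus with the product of the two curves. -/

namespace TwoCenter

open Real Set

/-! ### Clocks: scalar periodic autonomous equations. -/

/-- `Φ` is the solution of `Φ' = ω(Φ)`, `Φ 0 = 0`, of period `T` modulo `2π`, and passes through
the multiples of `π` at the multiples of `T / 2`. -/
structure IsClock (ω Φ : ℝ → ℝ) (T : ℝ) : Prop where
  pos : 0 < T
  hasDerivAt : ∀ t, HasDerivAt Φ (ω (Φ t)) t
  surjective : Function.Surjective Φ
  strictMono : StrictMono Φ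
  add : ∀ t (k : ℤ), Φ (t + k * T) = Φ t + k * (2 * π)
  half : ∀ k : ℤ, Φ (k * (T / 2)) = k * π

theorem IsClock.sub_eq_iff {ω Φ : ℝ → ℝ} {T : ℝ} (H : IsClock ω Φ T) (s t : ℝ) (k : ℤ) :
    Φ s - Φ t = k * (2 * π) ↔ s - t = k * T := by
  rw [sub_eq_iff_eq_add', ← H.add, H.strictMono.injective.eq_iff, sub_eq_iff_eq_add']

theorem IsClock.eq_half_iff {ω Φ : ℝ → ℝ} {T : ℝ} (H : IsClock ω Φ T) (t : ℝ) (k : ℤ) :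
    Φ t = k * π ↔ t = k * (T / 2) := by
  rw [← H.half, H.strictMono.injective.eq_iff]

/-- Separation of variables: `Φ` inverts `θ(x) = ∫₀ˣ du / ω(u)`, and `T = θ(2π)`. Evenness of `ω` is
what places `Φ` at `π` after exactly half a period. -/
theorem exists_isClock {ω : ℝ → ℝ} (hc : Continuous ω) (hpos : ∀ x, 0 < ω x)
    (heven : ∀ x, ω (-x) = ω x) (hper : Function.Periodic ω (2 * π)) :
    ∃ Φ T, IsClock ω Φ T := by
  have hci : Continuous fun x => (ω x)⁻¹ := hc.inv₀ fun x => (hpos x).ne'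
  have hint : ∀ a b, IntervalIntegrable (fun x => (ω x)⁻¹) MeasureTheory.volume a b :=
    fun a b => hci.intervalIntegrable a b
  have hperi : Function.Periodic (fun x => (ω x)⁻¹) (2 * π) := fun x => by
    simp only [hper x]
  set θ : ℝ → ℝ := fun x => ∫ u in (0 : ℝ)..x, (ω u)⁻¹ with hθ
  have hd : ∀ x, HasDerivAt θ (ω x)⁻¹ x := fun x =>
    intervalIntegral.integral_hasDerivAt_right (hint _ _)
      (hci.stronglyMeasurableAtFilter _ _) hci.continuousAt
  have hmono : StrictMono θ := strictMono_of_deriv_pos fun x => by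
    rw [(hd x).deriv]; exact inv_pos.2 (hpos x)
  have hcont : Continuous θ := continuous_iff_continuousAt.2 fun x => (hd x).continuousAt
  have h0 : θ 0 = 0 := by simp [hθ]
  set T := θ (2 * π) with hT
  have hTpos : 0 < T := by
    rw [← h0]; exact hmono (by positivity)
  have hodd : ∀ x, θ (-x) = -θ x := fun x => by
    have h := intervalIntegral.integral_comp_neg (a := 0) (b := x) (fun u => (ω u)⁻¹)
    simp only [heven, neg_zero] at h
    simp only [hθ]
    rw [h, intervalIntegral.integral_symm]
  have hstep : ∀ x, θ (x + 2 * π) = θ x + T := fun x => by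
    have h := hperi.intervalIntegral_add_eq x 0
    rw [zero_add] at h
    have h2 := intervalIntegral.integral_add_adjacent_intervals (hint 0 x) (hint x (x + 2 * π))
    simp only [hT, hθ]
    rw [← h, ← h2]
  have hadd : ∀ x (k : ℤ), θ (x + k * (2 * π)) = θ x + k * T := fun x k => by
    induction k with
    | zero => simp
    | succ n ih =>
      have := hstep (x + n * (2 * π))
      push_cast at ih ⊢
      rw [ih] at this
      rw [← sub_eq_zero] at this ⊢
      rw [← this]; ring_nf
    | pred n ih =>
      have := hstep (x + (-n - 1) * (2 * π))
      push_cast at ih ⊢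
      rw [show x + (-n - 1) * (2 * π) + 2 * π = x + -n * (2 * π) by ring, ih] at this
      linarith
  -- Going from `-π` to `π` adds `T`, and `θ` is odd, so `2 θ(π) = T`.
  have hpi : θ π = T / 2 := by
    have := hstep (-π)
    rw [hodd, show -π + 2 * π = π by ring] at this
    linarith
  have hhalf : ∀ k : ℤ, θ (k * π) = k * (T / 2) := fun k => by
    obtain ⟨j, rfl | rfl⟩ := Int.even_or_odd' k
    · have := hadd 0 j
      rw [h0] at this
      push_cast
      rw [show (2 * (j : ℝ)) * π = 0 + j * (2 * π) by ring, this]; ring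
    · have := hadd π j
      rw [hpi] at this
      push_cast
      rw [show (2 * (j : ℝ) + 1) * π = π + j * (2 * π) by ring, this]; ring
  have hsurj : Function.Surjective θ := fun y => by
    obtain ⟨n, hn⟩ := exists_nat_gt (|y| / T)
    rw [div_lt_iff₀ hTpos] at hn
    have h1 := hadd 0 n
    have h2 := hadd 0 (-n)
    rw [h0] at h1 h2
    push_cast at h1 h2
    have hy := abs_lt.1 hn
    have hab : (0 : ℝ) + -n * (2 * π) ≤ 0 + n * (2 * π) := by
      have : (0 : ℝ) ≤ n * (2 * π) := by positivity
      linarith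
    obtain ⟨x, -, hx⟩ := intermediate_value_Icc hab hcont.continuousOn
      (show y ∈ Icc _ _ by rw [h1, h2]; constructor <;> linarith)
    exact ⟨x, hx⟩
  set e := hmono.orderIsoOfSurjective θ hsurj with he
  have heθ : ∀ x, e x = θ x := fun x => rfl
  refine ⟨e.symm, T, hTpos, fun t => ?_, e.symm.surjective, e.symm.strictMono, fun t k => ?_,
    fun k => ?_⟩
  · have := HasDerivAt.of_local_left_inverse (f := θ) (g := e.symm) (a := t)
      e.symm.continuous.continuousAt (hd (e.symm t)) (inv_pos.2 (hpos _)).ne'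
      (Filter.Eventually.of_forall fun y => e.apply_symm_apply y)
    rwa [inv_inv] at this
  · rw [e.symm_apply_eq, heθ, hadd, ← heθ, e.apply_symm_apply]
  · rw [e.symm_apply_eq, heθ, hhalf]

/-! ### Uniqueness for Newton's equations. -/

/-- `(q, p)` solves Newton's equations `q' = p`, `p' = F(q)`. -/
def IsNewton (F q p : ℝ → ℝ) : Prop :=
  ∀ t, HasDerivAt q (p t) t ∧ HasDerivAt p (F (q t)) t

theorem IsNewton.shift {F q p : ℝ → ℝ} (H : IsNewton F q p) (s : ℝ) :
    IsNewton F (fun t => q (t + s)) fun t => p (t + s) :=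
  fun t => ⟨(H (t + s)).1.comp_add_const t s, (H (t + s)).2.comp_add_const t s⟩

theorem IsNewton.eq {F q p q' p' : ℝ → ℝ} (hF : ContDiff ℝ 1 F) (H : IsNewton F q p)
    (H' : IsNewton F q' p') {t₀ : ℝ} (hq : q t₀ = q' t₀) (hp : p t₀ = p' t₀) :
    q = q' ∧ p = p' := by
  set v : ℝ × ℝ → ℝ × ℝ := fun x => (x.2, F x.1) with hv
  have hvc : ContDiff ℝ 1 v := contDiff_snd.prodMk (hF.comp contDiff_fst)
  have key : (fun t => (q t, p t)) = fun t => (q' t, p' t) := by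
    have hd : ∀ t, HasDerivAt (fun t => (q t, p t)) (v (q t, p t)) t :=
      fun t => (H t).1.prodMk (H t).2
    have hd' : ∀ t, HasDerivAt (fun t => (q' t, p' t)) (v (q' t, p' t)) t :=
      fun t => (H' t).1.prodMk (H' t).2
    have hc := continuous_iff_continuousAt.2 fun t => (hd t).continuousAt
    have hc' := continuous_iff_continuousAt.2 fun t => (hd' t).continuousAt
    ext1 t
    obtain ⟨a, b, ht, ht₀⟩ : ∃ a b, t ∈ Ioo a b ∧ t₀ ∈ Ioo a b := by
      use (min (-|t|) (-|t₀|) - 1), (max |t| |t₀| + 1)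
      grind
    -- The field is only locally Lipschitz; a uniform constant exists on the compact set swept out
    -- by both solutions over `[a, b]`.
    obtain ⟨K, hK⟩ := (hvc.locallyLipschitz.locallyLipschitzOn
      (s := (fun t => (q t, p t)) '' Icc a b ∪ (fun t => (q' t, p' t)) '' Icc a b)
      ).exists_lipschitzOnWith_of_compact
        ((isCompact_Icc.image hc).union (isCompact_Icc.image hc'))
    exact ODE_solution_unique_of_mem_Ioo (v := fun _ => v) (fun _ _ => hK) ht₀
      (fun u hu => ⟨hd u, Or.inl (mem_image_of_mem _ (Ioo_subset_Icc_self hu))⟩)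
      (fun u hu => ⟨hd' u, Or.inr (mem_image_of_mem _ (Ioo_subset_Icc_self hu))⟩)
      (by simp only [hq, hp]) ht
  exact ⟨funext fun t => congrArg Prod.fst (congrFun key t),
    funext fun t => congrArg Prod.snd (congrFun key t)⟩

/-! ### Counting orbits of a linear flow with commensurable periods. -/

/-- Linear flow on a torus with commensurable periods: exactly two orbits meet the grid of
half periods, and each of them meets it in two distinct points. -/
theorem encard_orbits_through_half_periods {Z : Type*} {Γ : ℝ → ℝ → Z} {C : Set Z} {T₁ T₂ : ℝ}
    (h₁ : 0 < T₁) (h₂ : 0 < T₂) (hr : ∃ r : ℚ, T₂ / T₁ = r)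
    (hΓ : ∀ s r s' r', Γ s r = Γ s' r' ↔
      (∃ k : ℤ, s - s' = k * T₁) ∧ ∃ k : ℤ, r - r' = k * T₂)
    (hC : ∀ s r, Γ s r ∈ C ↔ (∃ k : ℤ, s = k * (T₁ / 2)) ∧ ∃ k : ℤ, r = k * (T₂ / 2)) :
    {O | ∃ s r, (range fun t => Γ (t + s) (t + r)) = O ∧
        ∃ t t', t < t' ∧ Γ (t + s) (t + r) ∈ C ∧ Γ (t' + s) (t' + r) ∈ C}.encard = 2 ∧
      ∀ s r t, Γ (t + s) (t + r) ∈ C →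
        ∃ t', Γ (t' + s) (t' + r) ∈ C ∧ Γ (t + s) (t + r) ≠ Γ (t' + s) (t' + r) := by
  obtain ⟨ρ, hρ⟩ := hr
  -- With `2w` the generator of `T₁ℤ + T₂ℤ`, the half periods are `qw` and `pw`.
  obtain ⟨w, q, p, hw, hq, hp, hcop, hT₁, hT₂⟩ : ∃ (w : ℝ) (q p : ℤ), 0 < w ∧ 0 < q ∧ 0 < p ∧
      IsCoprime q p ∧ T₁ = q * (2 * w) ∧ T₂ = p * (2 * w) := by
    have hρ0 : (0 : ℝ) < ρ := by rw [← hρ]; positivity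
    have hd : (0 : ℝ) < ρ.den := by exact_mod_cast ρ.pos
    have e : (ρ : ℝ) = ρ.num / ρ.den := Rat.cast_def ρ
    refine ⟨T₁ / ρ.den / 2, ρ.den, ρ.num, by positivity, by exact_mod_cast ρ.pos,
      Rat.num_pos.2 (by exact_mod_cast hρ0), ?_, ?_, ?_⟩
    · exact (Rat.isCoprime_num_den ρ).symm
    · push_cast; field_simp
    · rw [div_eq_iff h₁.ne'] at hρ
      rw [hρ, e]; field_simp
  have hq' : (0 : ℝ) < q := by exact_mod_cast hq
  have hp' : (0 : ℝ) < p := by exact_mod_cast hp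
  obtain ⟨a, b, hab⟩ := hcop
  have habR : (a : ℝ) * q + b * p = 1 := by exact_mod_cast hab
  -- The time `pqw` is `p` half periods of the first factor and `q` of the second. It returns to the
  -- same point only if `p` and `q` are both even, which coprimality excludes.
  have second : ∀ s r t, Γ (t + s) (t + r) ∈ C →
      Γ (t + p * q * w + s) (t + p * q * w + r) ∈ C ∧
        Γ (t + s) (t + r) ≠ Γ (t + p * q * w + s) (t + p * q * w + r) := fun s r t ht => by
    obtain ⟨⟨i, hi⟩, j, hj⟩ := (hC _ _).1 ht
    refine ⟨(hC _ _).2 ⟨⟨i + p, ?_⟩, j + q, ?_⟩, fun h => ?_⟩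
    · rw [hT₁] at hi ⊢; push_cast; linear_combination hi
    · rw [hT₂] at hj ⊢; push_cast; linear_combination hj
    · obtain ⟨⟨k, hk⟩, l, hl⟩ := (hΓ _ _ _ _).1 h
      have e1 : p = -(2 * k) := by
        have : (q * w) * (p : ℝ) = (q * w) * (-(2 * k)) := by rw [hT₁] at hk; linear_combination -hk
        exact_mod_cast mul_left_cancel₀ (by positivity) this
      have e2 : q = -(2 * l) := by
        have : (p * w) * (q : ℝ) = (p * w) * (-(2 * l)) := by rw [hT₂] at hl; linear_combination -hl
        exact_mod_cast mul_left_cancel₀ (by positivity) this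
      rw [e1, e2] at hab
      have : (2 : ℤ) ∣ 1 := ⟨-(a * l) - b * k, by rw [← hab]; ring⟩
      omega
  refine ⟨?_, fun s r t ht => ⟨_, (second s r t ht).1, (second s r t ht).2⟩⟩
  have eq_iff : ∀ s r s' r', ((range fun t => Γ (t + s) (t + r)) =
      range fun t => Γ (t + s') (t + r')) ↔ ∃ k : ℤ, (s - r) - (s' - r') = k * (2 * w) := by
    intro s r s' r'
    constructor
    · intro h
      obtain ⟨t, ht⟩ : Γ (0 + s) (0 + r) ∈ range fun t => Γ (t + s') (t + r') :=
        h ▸ mem_range_self 0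
      obtain ⟨⟨k, hk⟩, l, hl⟩ := (hΓ _ _ _ _).1 ht
      refine ⟨l * p - k * q, ?_⟩
      rw [hT₁] at hk; rw [hT₂] at hl
      push_cast; linear_combination hl - hk
    · rintro ⟨k, hk⟩
      -- By `aq + bp = 1`, a phase gap `2kw` is absorbed by `ka` full turns of the first factor and
      -- `-kb` of the second.
      have key : ∀ t, Γ (t + s) (t + r) =
          Γ (t + (s - s' - k * a * T₁) + s') (t + (s - s' - k * a * T₁) + r') := fun t => by
        refine (hΓ _ _ _ _).2 ⟨⟨k * a, by push_cast; ring⟩, -(k * b), ?_⟩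
        rw [hT₁, hT₂]; push_cast
        linear_combination -hk + k * 2 * w * habR
      apply Subset.antisymm
      · rintro _ ⟨t, rfl⟩
        exact ⟨_, (key t).symm⟩
      · rintro _ ⟨t, rfl⟩
        refine ⟨t - (s - s' - k * a * T₁), ?_⟩
        simp only [key]
        congr 1 <;> ring
  -- A grid point of phase difference `n(aq + bp)w = nw`; `n = 0, 1` represent the two orbits.
  have hcol : ∀ n : ℤ, Γ (0 + n * a * (q * w)) (0 + -n * b * (p * w)) ∈ C := fun n =>
    (hC _ _).2 ⟨⟨n * a, by rw [hT₁]; push_cast; ring⟩, -n * b, by rw [hT₂]; push_cast; ring⟩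
  have hset : {O | ∃ s r, (range fun t => Γ (t + s) (t + r)) = O ∧
        ∃ t t', t < t' ∧ Γ (t + s) (t + r) ∈ C ∧ Γ (t' + s) (t' + r) ∈ C} =
      {range fun t => Γ (t + 0) (t + 0), range fun t => Γ (t + a * (q * w)) (t + -b * (p * w))} := by
    ext O
    simp only [mem_ofPred_eq, mem_insert_iff, mem_singleton_iff]
    constructor
    · rintro ⟨s, r, rfl, t, -, -, ht, -⟩
      obtain ⟨⟨i, hi⟩, j, hj⟩ := (hC _ _).1 ht
      rw [hT₁] at hi; rw [hT₂] at hj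
      rw [eq_iff, eq_iff]
      -- A grid point has phase difference `(iq - jp)w`, so this parity decides which orbit it lies
      -- on.
      obtain ⟨k, hk | hk⟩ := Int.even_or_odd' (i * q - j * p)
      · left
        have hk' : (i * q - j * p : ℝ) = 2 * k := by exact_mod_cast hk
        exact ⟨k, by linear_combination hi - hj + w * hk'⟩
      · right
        have hk' : (i * q - j * p : ℝ) = 2 * k + 1 := by exact_mod_cast hk
        exact ⟨k, by linear_combination hi - hj + w * hk' - w * habR⟩
    · have hpq : (0 : ℝ) < p * q * w := by positivity
      have hgo : ∀ n : ℤ, ∃ s r, (range fun t => Γ (t + s) (t + r)) =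
          (range fun t => Γ (t + n * a * (q * w)) (t + -n * b * (p * w))) ∧
          ∃ t t', t < t' ∧ Γ (t + s) (t + r) ∈ C ∧ Γ (t' + s) (t' + r) ∈ C := fun n =>
        ⟨_, _, rfl, 0, 0 + p * q * w, by linarith, hcol n, (second _ _ _ (hcol n)).1⟩
      rintro (rfl | rfl)
      · simpa using hgo 0
      · simpa using hgo 1
  rw [hset, encard_pair]
  rw [Ne, eq_iff]
  rintro ⟨k, hk⟩
  have : w * (-1 : ℝ) = w * (2 * k) := by linear_combination hk + w * habR
  have := mul_left_cancel₀ hw.ne' this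
  have : (-1 : ℤ) = 2 * k := by exact_mod_cast this
  omega

/-! ### Periodic motions from parametrized level curves. -/

theorem exists_cos_sin_eq {x y : ℝ} (h : x ^ 2 + y ^ 2 = 1) : ∃ φ : ℝ, cos φ = x ∧ sin φ = y := by
  have hz : ‖(⟨x, y⟩ : ℂ)‖ = 1 := by
    rw [Complex.norm_def, Complex.normSq_mk, ← pow_two, ← pow_two, h, sqrt_one]
  have h0 : (⟨x, y⟩ : ℂ) ≠ 0 := fun h0 => by simp [h0] at hz
  exact ⟨Complex.arg ⟨x, y⟩, by rw [Complex.cos_arg h0, hz]; simp,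
    by rw [Complex.sin_arg, hz]; simp⟩

theorem cos_sin_eq_iff (φ ψ : ℝ) :
    (cos φ = cos ψ ∧ sin φ = sin ψ) ↔ ∃ k : ℤ, φ - ψ = k * (2 * π) := by
  constructor
  · rintro ⟨hc, hs⟩
    obtain ⟨k, hk⟩ := Real.Angle.angle_eq_iff_two_pi_dvd_sub.1 (Real.Angle.cos_sin_inj hc hs)
    exact ⟨k, by rw [hk]; ring⟩
  · rintro ⟨k, hk⟩
    rw [sub_eq_iff_eq_add'.1 hk]
    exact ⟨cos_add_int_mul_two_pi _ _, sin_add_int_mul_two_pi _ _⟩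

/-- A quadratic with positive leading coefficient that is negative at `x₀` has real roots on both
sides of `x₀`. -/
theorem exists_roots_of_neg {a b c x₀ : ℝ} (ha : 0 < a) (h : a * x₀ ^ 2 + b * x₀ + c < 0) :
    ∃ r₁ r₂, r₁ < x₀ ∧ x₀ < r₂ ∧ ∀ x, a * x ^ 2 + b * x + c = a * ((x - r₁) * (x - r₂)) := by
  have hD : (2 * a * x₀ + b) ^ 2 < b ^ 2 - 4 * a * c := by nlinarith
  have hs := sq_sqrt ((sq_nonneg _).trans hD.le)
  have hlt := Real.lt_sqrt_of_sq_lt ((sq_abs _).trans_lt hD)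
  set D := √(b ^ 2 - 4 * a * c)
  obtain ⟨h1, h2⟩ := abs_lt.1 hlt
  refine ⟨(-b - D) / (2 * a), (-b + D) / (2 * a), ?_, ?_, fun x => ?_⟩
  · rw [div_lt_iff₀ (by positivity)]; linarith
  · rw [lt_div_iff₀ (by positivity)]; linarith
  · field_simp
    linear_combination hs

/-- `(q, p)` is a solution of Newton's equations whose image, after the base has been mapped by
`ι`, is the closed curve `L`, traversed with least period `T`; it passes through the fibres over
`Z` at the multiples of `T / 2`. -/
structure IsPeriodicMotion {X : Type*} (ι : ℝ → X) (F : ℝ → ℝ) (L : X → ℝ → Prop) (Z : X → Prop)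
    (q p : ℝ → ℝ) (T : ℝ) : Prop where
  pos : 0 < T
  newton : IsNewton F q p
  eq_iff : ∀ s t, (ι (q s) = ι (q t) ∧ p s = p t) ↔ ∃ k : ℤ, s - t = k * T
  mem_iff : ∀ x y, L x y ↔ ∃ t, ι (q t) = x ∧ p t = y
  zero_iff : ∀ t, Z (ι (q t)) ↔ ∃ k : ℤ, t = k * (T / 2)

/-- Running through the curve `(Q, P)` with the clock `φ' = ω(φ)` solves Newton's equations by the
chain rule. Period and half-period statements are inherited from the clock. -/
theorem IsPeriodicMotion.of_curve {X : Type*} {ι : ℝ → X} {F : ℝ → ℝ} {L : X → ℝ → Prop}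
    {Z : X → Prop} {ω Q Q' P P' : ℝ → ℝ} (hc : Continuous ω) (hpos : ∀ x, 0 < ω x)
    (heven : ∀ x, ω (-x) = ω x) (hper : Function.Periodic ω (2 * π))
    (hQ : ∀ φ, HasDerivAt Q (Q' φ) φ) (hP : ∀ φ, HasDerivAt P (P' φ) φ)
    (hQ' : ∀ φ, Q' φ * ω φ = P φ) (hP' : ∀ φ, P' φ * ω φ = F (Q φ))
    (heq : ∀ φ ψ, (ι (Q φ) = ι (Q ψ) ∧ P φ = P ψ) ↔ (cos φ = cos ψ ∧ sin φ = sin ψ))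
    (hmem : ∀ x y, L x y ↔ ∃ φ, ι (Q φ) = x ∧ P φ = y)
    (hzero : ∀ φ, Z (ι (Q φ)) ↔ sin φ = 0) :
    ∃ q p T, IsPeriodicMotion ι F L Z q p T := by
  obtain ⟨Φ, T, H⟩ := exists_isClock hc hpos heven hper
  refine ⟨Q ∘ Φ, P ∘ Φ, T, H.pos, fun t => ⟨?_, ?_⟩, fun s t => ?_, fun x y => ?_, fun t => ?_⟩
  · have := (hQ (Φ t)).comp t (H.hasDerivAt t)
    rwa [hQ'] at this
  · have := (hP (Φ t)).comp t (H.hasDerivAt t)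
    rwa [hP'] at this
  · simp only [Function.comp_apply, heq, cos_sin_eq_iff, H.sub_eq_iff]
  · rw [hmem]
    exact H.surjective.exists
  · simp only [Function.comp_apply, hzero, sin_eq_zero_iff, ← H.eq_half_iff]
    exact exists_congr fun k => eq_comm

/-- Librations: the curve `p = 2 k cos φ √(A + B sin² φ)`, where `q` is a function of `φ` with
`dq/dφ = 2 k cos φ / √(1 + η sin² φ)`. -/
theorem IsPeriodicMotion.of_libration {X : Type*} {ι : ℝ → X} {F : ℝ → ℝ} {L : X → ℝ → Prop}
    {Z : X → Prop} {k A B η : ℝ} {Q : ℝ → ℝ} (hk : 0 < k)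
    (hη : ∀ φ, 0 < 1 + η * sin φ ^ 2) (hN : ∀ φ, 0 < A + B * sin φ ^ 2)
    (hQ : ∀ φ, HasDerivAt Q (2 * k * cos φ / √(1 + η * sin φ ^ 2)) φ)
    (hF : ∀ φ, F (Q φ) = 2 * (k * sin φ) * √(1 + η * sin φ ^ 2)
      * (B * cos φ ^ 2 - (A + B * sin φ ^ 2)))
    (hι : ∀ φ ψ, ι (Q φ) = ι (Q ψ) ↔ sin φ = sin ψ)
    (hmem : ∀ x y, L x y ↔ ∃ φ, ι (Q φ) = x ∧ 2 * k * cos φ * √(A + B * sin φ ^ 2) = y)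
    (hzero : ∀ φ, Z (ι (Q φ)) ↔ sin φ = 0) :
    ∃ q p T, IsPeriodicMotion ι F L Z q p T := by
  refine IsPeriodicMotion.of_curve
    (ω := fun φ => √(1 + η * sin φ ^ 2) * √(A + B * sin φ ^ 2)) (Q := Q)
    (P := fun φ => 2 * k * cos φ * √(A + B * sin φ ^ 2))
    (P' := fun φ => 2 * k * (-sin φ) * √(A + B * sin φ ^ 2)
      + 2 * k * cos φ * ((B * (2 * sin φ * cos φ)) / (2 * √(A + B * sin φ ^ 2))))
    (by fun_prop) (fun φ => mul_pos (sqrt_pos.2 (hη φ)) (sqrt_pos.2 (hN φ)))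
    (fun φ => by simp) (fun φ => by simp) hQ (fun φ => ?_) (fun φ => ?_) (fun φ => ?_)
    (fun φ ψ => ?_) hmem hzero
  · have h1 : HasDerivAt (fun φ => A + B * sin φ ^ 2) (B * (2 * sin φ * cos φ)) φ := by
      simpa using (((hasDerivAt_sin φ).pow 2).const_mul B).const_add A
    exact ((hasDerivAt_cos φ).const_mul (2 * k)).mul (h1.sqrt (hN φ).ne')
  · have := (sqrt_pos.2 (hη φ)).ne'
    field_simp
  · have := (sqrt_pos.2 (hN φ)).ne'
    have h2 := sq_sqrt (hN φ).le
    rw [hF]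
    generalize √(A + B * sin φ ^ 2) = R at *
    rw [← h2]
    field_simp
    ring
  · rw [hι, and_comm]
    refine and_congr_left fun hs => ?_
    rw [hs]
    have := (sqrt_pos.2 (hN ψ)).ne'
    constructor
    · intro h
      simpa [this, hk.ne'] using h
    · intro h; rw [h]

/-! ### The motions of the two separated systems. -/

/-- The force of `H_λ`. -/
noncomputable def forceLambda (d m₁ m₂ h q : ℝ) : ℝ :=
  d * (m₁ + m₂) * sinh q + 2 * (h * d ^ 2) * cosh q * sinh q

/-- The force of `H_ν`. -/
noncomputable def forceNu (d m₁ m₂ h q : ℝ) : ℝ :=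
  -(d * (m₁ - m₂) * cos q) - 2 * (h * d ^ 2) * sin q * cos q

/-- For `α = -hd²` the level is `p² = 2α(cosh λ - r₁)(r₂ - cosh λ)`, and `g < κ₊₊` says that the
roots satisfy `r₁ < 1 < r₂`. Since `cosh λ = 1 + 2 sinh²(λ/2)`, the substitution `sinh(λ/2) = k sin
φ` with `k² = (r₂ - 1)/2` turns `r₂ - cosh λ` into `2k² cos² φ`. -/
theorem exists_motion_lambda {d m₁ m₂ g h : ℝ} (hd : 0 < d) (hh : h < 0)
    (hg : g < kappaPP d m₁ m₂ h) :
    ∃ q p T, IsPeriodicMotion id (forceLambda d m₁ m₂ h)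
      (fun q p => hamLambda d m₁ m₂ h q p = -g) (· = 0) q p T := by
  obtain ⟨α, hα⟩ : ∃ α, α = -(h * d ^ 2) := ⟨_, rfl⟩
  have hα0 : 0 < α := by rw [hα]; have := sq_pos_of_pos hd; nlinarith
  rw [kappaPP] at hg
  obtain ⟨r₁, r₂, h1, h2, hr⟩ := exists_roots_of_neg (x₀ := 1) (b := -(d * (m₁ + m₂))) (c := g)
    hα0 (by rw [hα]; linarith)
  have hsum : α * (r₁ + r₂) = d * (m₁ + m₂) := by linear_combination (hr 1 - hr (-1)) / 2
  set k := √((r₂ - 1) / 2) with hk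
  have hk2 : k ^ 2 = (r₂ - 1) / 2 := sq_sqrt (by linarith)
  have hk0 : 0 < k := sqrt_pos.2 (by linarith)
  have hN : ∀ φ, 0 < α * (1 - r₁) + 2 * α * k ^ 2 * sin φ ^ 2 := fun φ => by
    have : 0 < α * (1 - r₁) := mul_pos hα0 (by linarith)
    positivity
  have hcosh : ∀ q, cosh q = 1 + 2 * sinh (q / 2) ^ 2 := fun q => by
    have := cosh_two_mul (q / 2)
    rw [cosh_sq] at this
    rw [show q = 2 * (q / 2) by ring, this]; ring_nf
  have hlev : ∀ q p, hamLambda d m₁ m₂ h q p = -g ↔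
      p ^ 2 = 2 * (α * ((cosh q - r₁) * (r₂ - cosh q))) := fun q p => by
    have := hr (cosh q)
    rw [hamLambda]
    constructor <;> intro h <;> rw [hα] at * <;> linarith
  refine IsPeriodicMotion.of_libration (k := k) (η := k ^ 2) (A := α * (1 - r₁))
    (B := 2 * α * k ^ 2) (Q := fun φ => 2 * arsinh (k * sin φ)) hk0 (fun φ => by positivity) hN
    (fun φ => ?_) (fun φ => ?_) (fun φ ψ => ?_) (fun q p => ?_) (fun φ => ?_)
  · have := (((hasDerivAt_sin φ).const_mul k).arsinh).const_mul 2
    rw [mul_pow, smul_eq_mul] at this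
    have e : 2 * k * cos φ / √(1 + k ^ 2 * sin φ ^ 2) =
        2 * ((√(1 + k ^ 2 * sin φ ^ 2))⁻¹ * (k * cos φ)) := by ring
    rw [e]
    exact this
  · have hc := hcosh (2 * arsinh (k * sin φ))
    have hs := sinh_two_mul (arsinh (k * sin φ))
    rw [mul_div_cancel_left₀ _ two_ne_zero, sinh_arsinh] at hc
    rw [sinh_arsinh, cosh_arsinh, mul_pow] at hs
    rw [forceLambda, hs, hc, cos_sq', ← hsum, show h * d ^ 2 = -α by rw [hα]; ring]
    linear_combination (-4 * k * sin φ * √(1 + k ^ 2 * sin φ ^ 2) * α) * hk2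
  · simp [hk0.ne']
  · rw [hlev]
    constructor
    · intro hp
      have hR : 0 < α * (cosh q - r₁) := mul_pos hα0 (by linarith [one_le_cosh q])
      obtain ⟨φ, hc, hs⟩ := exists_cos_sin_eq (x := p / (2 * k * √(α * (cosh q - r₁))))
        (y := sinh (q / 2) / k) (by
          rw [div_pow, div_pow, mul_pow, mul_pow, sq_sqrt hR.le, hp, hk2]
          have := hcosh q
          have : r₂ - 1 ≠ 0 := by linarith
          have : cosh q - r₁ ≠ 0 := by linarith [one_le_cosh q]
          field_simp
          linarith)
      have hs' : k * sin φ = sinh (q / 2) := by rw [hs]; field_simp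
      refine ⟨φ, ?_, ?_⟩
      · simp only [id, hs', arsinh_sinh]; ring
      · have : α * (1 - r₁) + 2 * α * k ^ 2 * sin φ ^ 2 = α * (cosh q - r₁) := by
          rw [hcosh q, ← hs']; ring
        rw [this, hc]
        have := (sqrt_pos.2 hR).ne'
        field_simp
    · rintro ⟨φ, rfl, rfl⟩
      have hc := hcosh (2 * arsinh (k * sin φ))
      rw [mul_div_cancel_left₀ _ two_ne_zero, sinh_arsinh] at hc
      simp only [id]
      rw [hc, mul_pow, mul_pow, sq_sqrt (hN φ).le, cos_sq']
      linear_combination 4 * (α * (1 - r₁) + 2 * α * k ^ 2 * sin φ ^ 2) * hk2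
  · simp [hk0.ne']

theorem hamNu_eq_iff {d m₁ m₂ g h : ℝ} (x : Real.Angle) (p : ℝ) :
    hamNu d m₁ m₂ h x p = g ↔
      p ^ 2 = 2 * (-(h * d ^ 2) * x.sin ^ 2 + -(d * (m₁ - m₂)) * x.sin + g) := by
  rw [hamNu]
  constructor <;> intro h <;> linarith

/-- Satellite motions: `ν` librates about `ε π / 2`. -/
theorem exists_motion_nu_libration {d m₁ m₂ g h ε s₀ : ℝ} (hd : 0 < d) (hh : h < 0)
    (hε : ε = 1 ∨ ε = -1) (hs₀ : -1 ≤ s₀) (hs₁ : s₀ < 1)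
    (hneg : -(h * d ^ 2) * s₀ ^ 2 + -(d * (m₁ - m₂) * ε) * s₀ + g < 0)
    (hpos : 0 < -(h * d ^ 2) * 1 ^ 2 + -(d * (m₁ - m₂) * ε) * 1 + g) :
    ∃ q p T, IsPeriodicMotion ((↑) : ℝ → Real.Angle) (forceNu d m₁ m₂ h)
      (fun x p => hamNu d m₁ m₂ h x p = g ∧ s₀ < ε * x.sin) (fun x => x.cos = 0) q p T := by
  obtain ⟨α, hα⟩ : ∃ α, α = -(h * d ^ 2) := ⟨_, rfl⟩
  have hα0 : 0 < α := by rw [hα]; have := sq_pos_of_pos hd; nlinarith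
  have hε2 : ε ^ 2 = 1 := by rcases hε with rfl | rfl <;> norm_num
  have hε0 : ε ≠ 0 := by rintro rfl; norm_num at hε2
  rw [← hα] at hneg hpos
  -- Write `ν = επ/2 + u`, so `sin ν = ε cos u` and the level is `p² = 2α(cos u - r₁)(cos u - r₂)`.
  -- Since `r₁ < s₀ < r₂ < 1`, the side `cos u > s₀` is the well `cos u ≥ r₂`, parametrized by
  -- `sin(u/2) = k sin φ`.
  obtain ⟨r₁, r₂, h1, h2, hr⟩ := exists_roots_of_neg hα0 hneg
  have hsum : α * (r₁ + r₂) = d * (m₁ - m₂) * ε := by linear_combination (hr 1 - hr (-1)) / 2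
  have h3 : r₂ < 1 := by
    rw [hr 1] at hpos
    have := pos_of_mul_pos_right hpos hα0.le
    have := pos_of_mul_pos_right this (by linarith)
    linarith
  set k := √((1 - r₂) / 2) with hk
  have hk2 : k ^ 2 = (1 - r₂) / 2 := sq_sqrt (by linarith)
  have hk0 : 0 < k := sqrt_pos.2 (by linarith)
  -- Here `k < 1` because `r₂ > s₀ ≥ -1`: the libration never reaches the opposite center `u = π`.
  have hη : ∀ φ, 0 < 1 + -k ^ 2 * sin φ ^ 2 := fun φ => by
    nlinarith [sin_sq_le_one φ, sq_nonneg (sin φ)]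
  have hN' : ∀ φ, α * (1 - r₁) + -(2 * α * k ^ 2) * sin φ ^ 2
      = α * (r₂ - r₁ + (1 - r₂) * cos φ ^ 2) := fun φ => by
    rw [hk2, cos_sq']; ring
  have hN : ∀ φ, 0 < α * (1 - r₁) + -(2 * α * k ^ 2) * sin φ ^ 2 := fun φ => by
    rw [hN']
    have : 0 < 1 - r₂ := by linarith
    have : 0 < r₂ - r₁ := by linarith
    positivity
  have hlt : ∀ φ, -1 < k * sin φ ∧ k * sin φ < 1 := fun φ => by
    apply abs_lt.1
    rw [← sq_lt_one_iff_abs_lt_one]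
    linarith [hη φ, mul_pow k (sin φ) 2]
  have hcos : ∀ u, cos u = 1 - 2 * sin (u / 2) ^ 2 := fun u => by
    have := cos_two_mul' (u / 2)
    rw [cos_sq'] at this
    rw [show u = 2 * (u / 2) by ring, this]; ring_nf
  have hshift : ∀ u, sin (ε * (π / 2) + u) = ε * cos u ∧ cos (ε * (π / 2) + u) = -ε * sin u := by
    rcases hε with rfl | rfl <;> intro u <;> simp [sin_add, cos_add]
  have hlev : ∀ (u : ℝ) p, (hamNu d m₁ m₂ h (ε * (π / 2) + u : ℝ) p = g ↔
      p ^ 2 = 2 * (α * ((cos u - r₁) * (cos u - r₂)))) := fun u p => by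
    have := hr (cos u)
    rw [hamNu_eq_iff, Real.Angle.sin_coe, (hshift u).1, ← hα, mul_pow, hε2]
    constructor <;> intro h <;> linarith
  set U : ℝ → ℝ := fun φ => 2 * arcsin (k * sin φ) with hU
  have hUs : ∀ φ, sin (U φ / 2) = k * sin φ := fun φ => by
    simp only [hU, mul_div_cancel_left₀ _ (two_ne_zero' ℝ)]
    exact sin_arcsin (hlt φ).1.le (hlt φ).2.le
  have hUc : ∀ φ, cos (U φ) = 1 - 2 * (k * sin φ) ^ 2 := fun φ => by rw [hcos, hUs]
  have hUs2 : ∀ φ, sin (U φ) = 2 * (k * sin φ) * √(1 + -k ^ 2 * sin φ ^ 2) := fun φ => by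
    have := sin_two_mul (arcsin (k * sin φ))
    rw [sin_arcsin (hlt φ).1.le (hlt φ).2.le, cos_arcsin] at this
    simp only [hU]
    rw [this]
    congr 2; ring
  refine IsPeriodicMotion.of_libration (k := k) (η := -k ^ 2) (A := α * (1 - r₁))
    (B := -(2 * α * k ^ 2)) (Q := fun φ => ε * (π / 2) + U φ) hk0 hη hN
    (fun φ => ?_) (fun φ => ?_) (fun φ ψ => ?_) (fun x p => ?_) (fun φ => ?_)
  · have := ((((hasDerivAt_arcsin (hlt φ).1.ne' (hlt φ).2.ne).comp φ
      ((hasDerivAt_sin φ).const_mul k))).const_mul 2).const_add (ε * (π / 2))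
    have e : 2 * k * cos φ / √(1 + -k ^ 2 * sin φ ^ 2) =
        2 * (1 / √(1 - (k * sin φ) ^ 2) * (k * cos φ)) := by
      rw [show 1 - (k * sin φ) ^ 2 = 1 + -k ^ 2 * sin φ ^ 2 by ring]; ring
    rw [e]
    exact this
  · have e : d * (m₁ - m₂) = α * (r₁ + r₂) * ε := by
      rw [hsum]; linear_combination (-(d * (m₁ - m₂))) * hε2
    rw [forceNu, (hshift _).1, (hshift _).2, hUc, hUs2, cos_sq', e,
      show h * d ^ 2 = -α by rw [hα]; ring]
    generalize √(1 + -k ^ 2 * sin φ ^ 2) = R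
    linear_combination
      (2 * k * sin φ * R * α * (r₁ + r₂ - 2 + 4 * k ^ 2 * sin φ ^ 2)) * hε2
        + (4 * k * sin φ * R * α) * hk2
  · constructor
    · intro h
      have hc := congrArg Real.Angle.cos h
      have hs := congrArg Real.Angle.sin h
      rw [Real.Angle.sin_coe, Real.Angle.sin_coe, (hshift _).1, (hshift _).1, hUc, hUc] at hs
      rw [Real.Angle.cos_coe, Real.Angle.cos_coe, (hshift _).2, (hshift _).2, hUs2, hUs2] at hc
      have hs2 := mul_left_cancel₀ hε0 hs
      have hc2 := mul_left_cancel₀ (neg_ne_zero.2 hε0) hc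
      have e : 1 + -k ^ 2 * sin φ ^ 2 = 1 + -k ^ 2 * sin ψ ^ 2 := by
        linear_combination hs2 / 2
      rw [e] at hc2
      have h4 := mul_right_cancel₀ (sqrt_pos.2 (hη ψ)).ne' hc2
      exact mul_left_cancel₀ hk0.ne' (mul_left_cancel₀ two_ne_zero h4)
    · intro h; simp only [hU, h]
  · constructor
    · rintro ⟨hx, hside⟩
      obtain ⟨u, hu, rfl⟩ : ∃ u ∈ Ioc (-π) π, ((ε * (π / 2) + u : ℝ) : Real.Angle) = x :=
        ⟨(x - (ε * (π / 2) : ℝ)).toReal, Real.Angle.toReal_mem_Ioc _, by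
          rw [Real.Angle.coe_add, Real.Angle.coe_toReal]; abel⟩
      rw [hlev] at hx
      rw [Real.Angle.sin_coe, (hshift _).1, ← mul_assoc, ← pow_two, hε2, one_mul] at hside
      have hR : 0 < α * (cos u - r₁) := mul_pos hα0 (by linarith)
      obtain ⟨φ, hc, hs⟩ := exists_cos_sin_eq (x := p / (2 * k * √(α * (cos u - r₁))))
        (y := sin (u / 2) / k) (by
          rw [div_pow, div_pow, mul_pow, mul_pow, sq_sqrt hR.le, hx, hk2]
          have := hcos u
          have : 1 - r₂ ≠ 0 := by linarith
          have : cos u - r₁ ≠ 0 := by linarith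
          field_simp
          linarith)
      have hs' : k * sin φ = sin (u / 2) := by rw [hs]; field_simp
      refine ⟨φ, ?_, ?_⟩
      · have : U φ = u := by
          simp only [hU, hs']
          rw [arcsin_sin (by linarith [hu.1]) (by linarith [hu.2])]; ring
        simp only [this]
      · have : α * (1 - r₁) + -(2 * α * k ^ 2) * sin φ ^ 2 = α * (cos u - r₁) := by
          rw [hcos u, ← hs']; ring
        rw [this, hc]
        have := (sqrt_pos.2 hR).ne'
        field_simp
    · rintro ⟨φ, rfl, rfl⟩
      rw [hlev, Real.Angle.sin_coe, (hshift _).1, ← mul_assoc ε, ← pow_two, hε2, one_mul, hUc]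
      constructor
      · rw [mul_pow, mul_pow, sq_sqrt (hN φ).le, cos_sq']
        linear_combination
          4 * (α * (1 - r₁) + -(2 * α * k ^ 2) * sin φ ^ 2) * hk2
      · rw [mul_pow, hk2]
        nlinarith [sin_sq_le_one φ]
  · rw [Real.Angle.cos_coe, (hshift _).2, hUs2]
    exact ⟨fun h => by simpa only [mul_eq_zero, neg_eq_zero, hε0, hk0.ne', two_ne_zero,
      (sqrt_pos.2 (hη φ)).ne', or_false, false_or] using h, fun h => by rw [h]; ring⟩

/-- Lemniscate motions: `ν` rotates in the direction `σ`. -/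
theorem exists_motion_nu_rotation {d m₁ m₂ g h σ : ℝ} (hσ : σ = 1 ∨ σ = -1)
    (hpos : ∀ s ∈ Icc (-1 : ℝ) 1, 0 < -(h * d ^ 2) * s ^ 2 + -(d * (m₁ - m₂)) * s + g) :
    ∃ q p T, IsPeriodicMotion ((↑) : ℝ → Real.Angle) (forceNu d m₁ m₂ h)
      (fun x p => hamNu d m₁ m₂ h x p = g ∧ 0 < σ * p) (fun x => x.cos = 0) q p T := by
  have hσ2 : σ ^ 2 = 1 := by rcases hσ with rfl | rfl <;> norm_num
  have hV : ∀ φ, 0 < 2 * (-(h * d ^ 2) * cos φ ^ 2 + -(d * (m₁ - m₂)) * cos φ + g) :=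
    fun φ => by have := hpos _ (cos_mem_Icc φ); linarith
  set V : ℝ → ℝ := fun φ => 2 * (-(h * d ^ 2) * cos φ ^ 2 + -(d * (m₁ - m₂)) * cos φ + g) with hVdef
  have hsin : ∀ φ, sin (π / 2 + σ * φ) = cos φ := by
    rcases hσ with rfl | rfl <;> simp [sin_add]
  have hcos : ∀ φ, cos (π / 2 + σ * φ) = -(σ * sin φ) := by
    rcases hσ with rfl | rfl <;> simp [cos_add]
  -- Measuring the angle from `π/2` makes `V` a function of `cos φ`, hence even, and turns `cos ν =
  -- 0` into `sin φ = 0`.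
  refine IsPeriodicMotion.of_curve (ω := fun φ => √(V φ)) (Q := fun φ => π / 2 + σ * φ)
    (Q' := fun _ => σ) (P := fun φ => σ * √(V φ))
    (P' := fun φ => σ * ((2 * (-(h * d ^ 2) * (2 * cos φ * (-sin φ))
      + -(d * (m₁ - m₂)) * (-sin φ))) / (2 * √(V φ))))
    (by fun_prop) (fun φ => sqrt_pos.2 (hV φ)) (fun φ => by simp [hVdef]) (fun φ => by simp [hVdef])
    (fun φ => by simpa using ((hasDerivAt_id φ).const_mul σ).const_add (π / 2)) (fun φ => ?_)
    (fun φ => rfl) (fun φ => ?_) (fun φ ψ => ?_) (fun x p => ?_) (fun φ => ?_)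
  · have h1 : HasDerivAt V (2 * (-(h * d ^ 2) * (2 * cos φ * (-sin φ))
      + -(d * (m₁ - m₂)) * (-sin φ))) φ := by
      have h2 : HasDerivAt (fun φ => cos φ ^ 2) (2 * cos φ * (-sin φ)) φ := by
        have := (hasDerivAt_cos φ).pow 2
        simp only [Nat.cast_ofNat, Nat.add_one_sub_one, pow_one] at this
        exact this
      exact (((h2.const_mul _).add ((hasDerivAt_cos φ).const_mul _)).add_const g).const_mul 2
    exact (h1.sqrt (hV φ).ne').const_mul σ
  · have := (sqrt_pos.2 (hV φ)).ne'
    rw [forceNu, hsin, hcos]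
    generalize √(V φ) = R at *
    field_simp
    ring
  · constructor
    · rintro ⟨hx, -⟩
      have hc := congrArg Real.Angle.cos hx
      have hs := congrArg Real.Angle.sin hx
      simp only [Real.Angle.cos_coe, Real.Angle.sin_coe, hsin, hcos] at hc hs
      exact ⟨hs, by rcases hσ with rfl | rfl <;> linarith⟩
    · rintro ⟨hc, hs⟩
      exact ⟨Real.Angle.cos_sin_inj (by rw [hcos, hcos, hs]) (by rw [hsin, hsin, hc]),
        by simp only [hVdef, hc]⟩
  · rw [hamNu_eq_iff]
    constructor
    · rintro ⟨hp, hσp⟩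
      obtain ⟨y, rfl⟩ : ∃ y : ℝ, (y : Real.Angle) = x := ⟨x.toReal, x.coe_toReal⟩
      have hy : π / 2 + σ * (σ * (y - π / 2)) = y := by
        linear_combination (y - π / 2) * hσ2
      refine ⟨σ * (y - π / 2), by rw [hy], ?_⟩
      have : V (σ * (y - π / 2)) = (σ * p) ^ 2 := by
        rw [mul_pow, hp, hσ2, one_mul, Real.Angle.sin_coe]
        simp only [hVdef, ← hsin, hy]
      rw [this, sqrt_sq hσp.le]
      linear_combination p * hσ2
    · rintro ⟨φ, rfl, rfl⟩
      rw [Real.Angle.sin_coe, hsin, mul_pow, sq_sqrt (hV φ).le, hσ2, one_mul]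
      refine ⟨rfl, ?_⟩
      have := sqrt_pos.2 (hV φ)
      rw [show σ * (σ * √(V φ)) = σ ^ 2 * √(V φ) by ring, hσ2]
      linarith
  · rw [Real.Angle.cos_coe, hcos]
    have : σ ≠ 0 := by rintro rfl; norm_num at hσ2
    simp [this]

/-! ### Trajectories, collisions and connectedness. -/

theorem isTrajectory_iff {d m₁ m₂ h : ℝ} {γ : ℝ → PhaseSpace} :
    IsTrajectory d m₁ m₂ h γ ↔ ∃ l n pl pn : ℝ → ℝ,
      (∀ τ, γ τ = (l τ, (n τ : Real.Angle), pl τ, pn τ)) ∧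
      IsNewton (forceLambda d m₁ m₂ h) l pl ∧ IsNewton (forceNu d m₁ m₂ h) n pn := by
  have hp : ∀ p : ℝ, HasDerivAt (fun p : ℝ => p ^ 2 / 2) p p := fun p => by
    have := ((hasDerivAt_id p).pow 2).div_const 2
    simpa [mul_div_assoc] using this
  have h1 : ∀ q p, deriv (fun p => hamLambda d m₁ m₂ h q p) p = p := fun q p =>
    (((hp p).sub_const _).sub_const _).deriv
  have h2 : ∀ (x : Real.Angle) p, deriv (fun p => hamNu d m₁ m₂ h x p) p = p := fun x p =>
    (((hp p).add_const _).add_const _).deriv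
  have h3 : ∀ q p, -deriv (fun q => hamLambda d m₁ m₂ h q p) q = forceLambda d m₁ m₂ h q :=
    fun q p => by
    have := (((hasDerivAt_cosh q).const_mul (d * (m₁ + m₂))).const_sub (p ^ 2 / 2)).sub
      (((hasDerivAt_cosh q).pow 2).const_mul (h * d ^ 2))
    have e := this.deriv
    refine (congrArg Neg.neg e).trans ?_
    rw [forceLambda]; push_cast; ring
  have h4 : ∀ q p, -deriv (fun q : ℝ => hamNu d m₁ m₂ h q p) q = forceNu d m₁ m₂ h q :=
    fun q p => by
    have := (((hasDerivAt_sin q).const_mul (d * (m₁ - m₂))).const_add (p ^ 2 / 2)).add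
      (((hasDerivAt_sin q).pow 2).const_mul (h * d ^ 2))
    have e := this.deriv
    refine (congrArg Neg.neg e).trans ?_
    rw [forceNu]; push_cast; ring
  simp only [IsTrajectory, h1, h2, h3, h4, IsNewton, forall_and]
  simp only [and_assoc, and_left_comm]

theorem contDiff_forceLambda (d m₁ m₂ h : ℝ) : ContDiff ℝ 1 (forceLambda d m₁ m₂ h) := by
  have := contDiff_sinh (n := 1)
  have := contDiff_cosh (n := 1)
  unfold forceLambda
  fun_prop

theorem contDiff_forceNu (d m₁ m₂ h : ℝ) : ContDiff ℝ 1 (forceNu d m₁ m₂ h) := by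
  unfold forceNu
  fun_prop

theorem forceNu_periodic (d m₁ m₂ h : ℝ) (q : ℝ) (k : ℤ) :
    forceNu d m₁ m₂ h (q + k * (2 * π)) = forceNu d m₁ m₂ h q := by
  rw [forceNu, sin_add_int_mul_two_pi, cos_add_int_mul_two_pi, forceNu]

theorem mem_collisions_iff {d : ℝ} (hd : 0 < d) (z : PhaseSpace) :
    z ∈ collisions d ↔ z.1 = 0 ∧ z.2.1.cos = 0 := by
  have hc := z.2.1.cos_sq_add_sin_sq
  have h1 := one_le_cosh z.1
  simp only [collisions, position, mem_ofPred_eq, Prod.mk.injEq]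
  constructor
  · intro h
    have hs : (cosh z.1 * z.2.1.sin) ^ 2 = 1 := by
      rcases h with ⟨h, -⟩ | ⟨h, -⟩
      · have := mul_left_cancel₀ hd.ne' (h.trans (mul_neg_one d).symm)
        rw [this]; norm_num
      · have := mul_left_cancel₀ hd.ne' (h.trans (mul_one d).symm)
        rw [this]; norm_num
    have hp : sinh z.1 * z.2.1.cos = 0 := by
      rcases h with ⟨-, h⟩ | ⟨-, h⟩ <;> simpa [hd.ne'] using h
    rcases mul_eq_zero.1 hp with h0 | h0
    · have h0' : z.1 = 0 := sinh_eq_zero.1 h0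
      rw [h0', cosh_zero, one_mul] at hs
      exact ⟨h0', by nlinarith⟩
    -- If `cos ν = 0` then `sin² ν = 1`, which forces `cosh² λ = 1`.
    · have : z.2.1.sin ^ 2 = 1 := by rw [h0] at hc; linarith
      rw [mul_pow, this, mul_one, cosh_sq] at hs
      exact ⟨sinh_eq_zero.1 (by nlinarith), h0⟩
  · rintro ⟨h0, h2⟩
    rw [h2] at hc
    have : (z.2.1.sin + 1) * (z.2.1.sin - 1) = 0 := by linarith
    rw [h0, h2, cosh_zero]
    rcases mul_eq_zero.1 this with h | h
    · left; rw [eq_neg_of_add_eq_zero_left h]; simp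
    · right; rw [sub_eq_zero.1 h]; simp

theorem IsPreconnected.pos_of_pos {X : Type*} [TopologicalSpace X] {s : Set X}
    (hs : IsPreconnected s) {f : X → ℝ} (hf : ContinuousOn f s) (h0 : ∀ x ∈ s, f x ≠ 0) {z : X}
    (hz : z ∈ s) (hfz : 0 < f z) {x : X} (hx : x ∈ s) : 0 < f x := by
  by_contra hle
  obtain ⟨y, hy, hy0⟩ := hs.intermediate_value hx hz hf ⟨not_lt.1 hle, hfz.le⟩
  exact h0 y hy hy0

/-! ### From the factor motions to the torus. -/

section Torus

variable {d m₁ m₂ g h : ℝ} {Lν : Real.Angle → ℝ → Prop} {l pl n pn : ℝ → ℝ} {T₁ T₂ : ℝ}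

theorem exists_shift_lambda {L : ℝ → ℝ → Prop}
    (H : IsPeriodicMotion id (forceLambda d m₁ m₂ h) L (· = 0) l pl T₁) {q p : ℝ → ℝ}
    (hq : IsNewton (forceLambda d m₁ m₂ h) q p) (h0 : L (q 0) (p 0)) :
    ∃ s, ∀ t, q t = l (t + s) ∧ p t = pl (t + s) := by
  obtain ⟨s, h1, h2⟩ := (H.mem_iff _ _).1 h0
  have := hq.eq (contDiff_forceLambda ..) (H.newton.shift s) (t₀ := 0)
    (by simpa using h1.symm) (by simpa using h2.symm)
  exact ⟨s, fun t => ⟨congrFun this.1 t, congrFun this.2 t⟩⟩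

/-- The initial point lies on the curve, but the real lifts may differ by a multiple of `2π`.
Periodicity of the force allows correcting the lift before uniqueness is applied. -/
theorem exists_shift_nu
    (H : IsPeriodicMotion (↑) (forceNu d m₁ m₂ h) Lν (fun x => x.cos = 0) n pn T₂) {q p : ℝ → ℝ}
    (hq : IsNewton (forceNu d m₁ m₂ h) q p) (h0 : Lν (q 0) (p 0)) :
    ∃ s, ∀ t, (q t : Real.Angle) = n (t + s) ∧ p t = pn (t + s) := by
  obtain ⟨s, h1, h2⟩ := (H.mem_iff _ _).1 h0
  obtain ⟨k, hk⟩ := Real.Angle.angle_eq_iff_two_pi_dvd_sub.1 h1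
  have hn : IsNewton (forceNu d m₁ m₂ h) (fun t => q t + k * (2 * π)) p := fun t =>
    ⟨(hq t).1.add_const _, by rw [forceNu_periodic]; exact (hq t).2⟩
  have := hn.eq (contDiff_forceNu ..) (H.newton.shift s) (t₀ := 0)
    (by simp only [zero_add]; linarith) (by simpa using h2.symm)
  refine ⟨s, fun t => ⟨?_, congrFun this.2 t⟩⟩
  rw [← congrFun this.1 t]
  exact Real.Angle.angle_eq_iff_two_pi_dvd_sub.2 ⟨-k, by push_cast; ring⟩

theorem IsPeriodicMotion.isLeast_period {X : Type*} {ι : ℝ → X} {F : ℝ → ℝ} {L : X → ℝ → Prop}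
    {Z : X → Prop} {q p : ℝ → ℝ} {T : ℝ} (H : IsPeriodicMotion ι F L Z q p T) :
    IsLeast {P : ℝ | 0 < P ∧ ∀ s, Function.Periodic (fun t => (ι (q (t + s)), p (t + s))) P} T := by
  refine ⟨⟨H.pos, fun s t => ?_⟩, fun P ⟨hP, h⟩ => ?_⟩
  · rw [Prod.mk.injEq, H.eq_iff]
    exact ⟨1, by push_cast; ring⟩
  · have := h 0 0
    rw [Prod.mk.injEq, H.eq_iff] at this
    obtain ⟨k, hk⟩ := this
    have hk' : P = k * T := by rw [← hk]; ring
    have hk0 : (0 : ℝ) < k := pos_of_mul_pos_left (hk' ▸ hP) H.pos.le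
    have hk1 : (1 : ℝ) ≤ k := by exact_mod_cast (Int.cast_pos.1 hk0 : 0 < k)
    rw [hk']
    nlinarith [H.pos]

/-- By uniqueness, the trajectories in `T` are exactly `t ↦ Γ (t + s) (t + r)`. This identifies both
least periods with `T₁`, `T₂` and reduces the claim to the linear flow. -/
theorem collisionCollisionOrbits_of_motions (hd : 0 < d) {T : Set PhaseSpace}
    (H₁ : IsPeriodicMotion id (forceLambda d m₁ m₂ h)
      (fun q p => hamLambda d m₁ m₂ h q p = -g) (· = 0) l pl T₁)
    (H₂ : IsPeriodicMotion (↑) (forceNu d m₁ m₂ h) Lν (fun x => x.cos = 0) n pn T₂)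
    (hT : T = {z | hamLambda d m₁ m₂ h z.1 z.2.2.1 = -g ∧ Lν z.2.1 z.2.2.2})
    (hW : ∃ r : ℚ, rotationNumber d m₁ m₂ h T = r) :
    (collisionCollisionOrbits d m₁ m₂ h T).encard = 2 ∧
      ∀ O ∈ collisionCollisionOrbits d m₁ m₂ h T,
        ∃ P ∈ O, ∃ Q ∈ O, P ≠ Q ∧ P ∈ collisions d ∧ Q ∈ collisions d := by
  set Γ : ℝ → ℝ → PhaseSpace := fun s r => (l s, (n r : Real.Angle), pl s, pn r) with hΓ
  have htraj : ∀ γ, (IsTrajectory d m₁ m₂ h γ ∧ range γ ⊆ T) ↔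
      ∃ s r, γ = fun t => Γ (t + s) (t + r) := by
    intro γ
    rw [isTrajectory_iff]
    constructor
    · rintro ⟨⟨q, x, pq, px, hγ, hq, hx⟩, hr⟩
      have h0 := hr (mem_range_self 0)
      rw [hT, hγ] at h0
      obtain ⟨s, hs⟩ := exists_shift_lambda H₁ hq h0.1
      obtain ⟨r, hr⟩ := exists_shift_nu H₂ hx h0.2
      exact ⟨s, r, funext fun t => by rw [hγ, (hs t).1, (hs t).2, (hr t).1, (hr t).2]⟩
    · rintro ⟨s, r, rfl⟩
      refine ⟨⟨_, _, _, _, fun _ => rfl, H₁.newton.shift s, H₂.newton.shift r⟩, ?_⟩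
      rintro _ ⟨t, rfl⟩
      rw [hT]
      exact ⟨(H₁.mem_iff _ _).2 ⟨_, rfl, rfl⟩, (H₂.mem_iff _ _).2 ⟨_, rfl, rfl⟩⟩
  have hpl : periodLambda d m₁ m₂ h T = T₁ := by
    rw [← H₁.isLeast_period.csInf_eq, periodLambda]
    congr 1
    ext P
    refine and_congr_right fun _ => ⟨fun hP s => ?_, fun hP γ h1 h2 => ?_⟩
    · obtain ⟨h1, h2⟩ := (htraj _).2 ⟨s, 0, rfl⟩
      exact hP _ h1 h2
    · obtain ⟨s, r, rfl⟩ := (htraj _).1 ⟨h1, h2⟩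
      exact hP s
  have hpn : periodNu d m₁ m₂ h T = T₂ := by
    rw [← H₂.isLeast_period.csInf_eq, periodNu]
    congr 1
    ext P
    refine and_congr_right fun _ => ⟨fun hP r => ?_, fun hP γ h1 h2 => ?_⟩
    · obtain ⟨h1, h2⟩ := (htraj _).2 ⟨0, r, rfl⟩
      exact hP _ h1 h2
    · obtain ⟨s, r, rfl⟩ := (htraj _).1 ⟨h1, h2⟩
      exact hP r
  rw [rotationNumber, hpl, hpn] at hW
  obtain ⟨hcard, htwo⟩ := encard_orbits_through_half_periods (Γ := Γ) (C := collisions d)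
    H₁.pos H₂.pos hW
    (fun s r s' r' => by
      rw [← H₁.eq_iff, ← H₂.eq_iff]
      simp only [hΓ, Prod.mk.injEq, id]
      tauto)
    (fun s r => by
      rw [mem_collisions_iff hd, ← H₁.zero_iff, ← H₂.zero_iff]
      rfl)
  have hset : collisionCollisionOrbits d m₁ m₂ h T =
      {O | ∃ s r, (range fun t => Γ (t + s) (t + r)) = O ∧ ∃ t t', t < t' ∧
        Γ (t + s) (t + r) ∈ collisions d ∧ Γ (t' + s) (t' + r) ∈ collisions d} := by
    ext O
    constructor
    · rintro ⟨γ, h1, rfl, h2, t, t', hlt, h3, h4⟩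
      obtain ⟨s, r, rfl⟩ := (htraj _).1 ⟨h1, h2⟩
      exact ⟨s, r, rfl, t, t', hlt, h3, h4⟩
    · rintro ⟨s, r, rfl, hcol⟩
      obtain ⟨h1, h2⟩ := (htraj _).2 ⟨s, r, rfl⟩
      exact ⟨_, h1, rfl, h2, hcol⟩
  rw [hset]
  refine ⟨hcard, ?_⟩
  rintro _ ⟨s, r, rfl, t, -, -, ht, -⟩
  obtain ⟨t', h1, h2⟩ := htwo s r t ht
  exact ⟨_, mem_range_self t, _, mem_range_self t', h2, ht, h1⟩

/-- `f` has no zero on the level set, so its sign is constant on the component; conversely, the set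
cut out by `side` is a continuous image of `ℝ²`, hence connected. -/
theorem connectedComponentIn_levelSet_eq {side : Real.Angle → ℝ → Prop}
    (H₁ : IsPeriodicMotion id (forceLambda d m₁ m₂ h)
      (fun q p => hamLambda d m₁ m₂ h q p = -g) (· = 0) l pl T₁)
    (H₂ : IsPeriodicMotion (↑) (forceNu d m₁ m₂ h)
      (fun x p => hamNu d m₁ m₂ h x p = g ∧ side x p) (fun x => x.cos = 0) n pn T₂)
    {f : Real.Angle → ℝ → ℝ} (hf : Continuous fun y : Real.Angle × ℝ => f y.1 y.2)
    (hside : ∀ x p, side x p ↔ 0 < f x p) (hf0 : ∀ x p, hamNu d m₁ m₂ h x p = g → f x p ≠ 0)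
    {z : PhaseSpace} (hz : z ∈ levelSet d m₁ m₂ g h) (hsz : side z.2.1 z.2.2.2) :
    connectedComponentIn (levelSet d m₁ m₂ g h) z =
      {z | hamLambda d m₁ m₂ h z.1 z.2.2.1 = -g ∧
        hamNu d m₁ m₂ h z.2.1 z.2.2.2 = g ∧ side z.2.1 z.2.2.2} := by
  apply Subset.antisymm
  · intro y hy
    have hlev := connectedComponentIn_subset _ _ hy
    refine ⟨hlev.1, hlev.2, (hside _ _).2 ?_⟩
    exact IsPreconnected.pos_of_pos isPreconnected_connectedComponentIn
      (f := fun z : PhaseSpace => f z.2.1 z.2.2.2)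
      (hf.comp (by fun_prop : Continuous fun z : PhaseSpace => (z.2.1, z.2.2.2))).continuousOn
      (fun x hx => hf0 _ _ (connectedComponentIn_subset _ _ hx).2)
      (mem_connectedComponentIn hz) ((hside _ _).1 hsz) hy
  · have hl : Continuous l := continuous_iff_continuousAt.2 fun t => (H₁.newton t).1.continuousAt
    have hpl : Continuous pl := continuous_iff_continuousAt.2 fun t => (H₁.newton t).2.continuousAt
    have hn : Continuous n := continuous_iff_continuousAt.2 fun t => (H₂.newton t).1.continuousAt
    have hpn : Continuous pn := continuous_iff_continuousAt.2 fun t => (H₂.newton t).2.continuousAt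
    have hcont : Continuous fun y : ℝ × ℝ =>
        ((l y.1, (n y.2 : Real.Angle), pl y.1, pn y.2) : PhaseSpace) := by
      have : Continuous ((↑) : ℝ → Real.Angle) := Real.Angle.continuous_coe
      fun_prop
    have hrange : {z : PhaseSpace | hamLambda d m₁ m₂ h z.1 z.2.2.1 = -g ∧
        hamNu d m₁ m₂ h z.2.1 z.2.2.2 = g ∧ side z.2.1 z.2.2.2} =
        range fun y : ℝ × ℝ => ((l y.1, (n y.2 : Real.Angle), pl y.1, pn y.2) : PhaseSpace) := by
      ext y
      constructor
      · rintro ⟨h1, h2⟩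
        obtain ⟨s, hs1, hs2⟩ := (H₁.mem_iff _ _).1 h1
        obtain ⟨r, hr1, hr2⟩ := (H₂.mem_iff _ _).1 h2
        exact ⟨(s, r), Prod.ext hs1 (Prod.ext hr1 (Prod.ext hs2 hr2))⟩
      · rintro ⟨⟨s, r⟩, rfl⟩
        exact ⟨(H₁.mem_iff _ _).2 ⟨_, rfl, rfl⟩, (H₂.mem_iff _ _).2 ⟨_, rfl, rfl⟩⟩
    refine IsPreconnected.subset_connectedComponentIn ?_ ⟨hz.1, hz.2, hsz⟩ fun y hy => ⟨hy.1, hy.2.1⟩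
    rw [hrange]
    exact isPreconnected_range hcont

theorem collisionCollisionOrbits_of_component (hd : 0 < d) (hh : h < 0)
    (hg : g < kappaPP d m₁ m₂ h) {side : Real.Angle → ℝ → Prop}
    (H : ∃ n pn T₂, IsPeriodicMotion (↑) (forceNu d m₁ m₂ h)
      (fun x p => hamNu d m₁ m₂ h x p = g ∧ side x p) (fun x => x.cos = 0) n pn T₂)
    {f : Real.Angle → ℝ → ℝ} (hf : Continuous fun y : Real.Angle × ℝ => f y.1 y.2)
    (hside : ∀ x p, side x p ↔ 0 < f x p) (hf0 : ∀ x p, hamNu d m₁ m₂ h x p = g → f x p ≠ 0)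
    {z : PhaseSpace} (hz : z ∈ levelSet d m₁ m₂ g h) (hsz : side z.2.1 z.2.2.2)
    {T : Set PhaseSpace} (hT : T = connectedComponentIn (levelSet d m₁ m₂ g h) z)
    (hW : ∃ r : ℚ, rotationNumber d m₁ m₂ h T = r) :
    (collisionCollisionOrbits d m₁ m₂ h T).encard = 2 ∧
      ∀ O ∈ collisionCollisionOrbits d m₁ m₂ h T,
        ∃ P ∈ O, ∃ Q ∈ O, P ≠ Q ∧ P ∈ collisions d ∧ Q ∈ collisions d := by
  obtain ⟨l, pl, T₁, H₁⟩ := exists_motion_lambda hd hh hg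
  obtain ⟨n, pn, T₂, H₂⟩ := H
  exact collisionCollisionOrbits_of_motions hd H₁ H₂
    (hT.trans (connectedComponentIn_levelSet_eq H₁ H₂ hf hside hf0 hz hsz)) hW

end Torus

/-! ### Satellite and lemniscate tori. -/

theorem abs_sin_le_one (x : Real.Angle) : |x.sin| ≤ 1 := by
  rw [← sq_le_one_iff_abs_le_one]
  nlinarith [x.cos_sq_add_sin_sq, sq_nonneg x.cos]

theorem quadratic_nonneg_of_hamNu_eq {d m₁ m₂ g h : ℝ} {x : Real.Angle} {p : ℝ}
    (hx : hamNu d m₁ m₂ h x p = g) :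
    0 ≤ -(h * d ^ 2) * x.sin ^ 2 + -(d * (m₁ - m₂)) * x.sin + g := by
  rw [hamNu_eq_iff] at hx
  nlinarith [sq_nonneg p]

/-- Satellite tori: the value `ε s₀` of `sin ν` is forbidden, and `ν = ε π / 2` is allowed. -/
theorem collisionCollisionOrbits_of_libration {d m₁ m₂ g h ε s₀ : ℝ} (hd : 0 < d) (hh : h < 0)
    (hg : g < kappaPP d m₁ m₂ h) (hε : ε = 1 ∨ ε = -1) (hs₀ : -1 ≤ s₀) (hs₁ : s₀ < 1)
    (hneg : -(h * d ^ 2) * s₀ ^ 2 + -(d * (m₁ - m₂) * ε) * s₀ + g < 0)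
    (hpos : 0 < -(h * d ^ 2) * 1 ^ 2 + -(d * (m₁ - m₂) * ε) * 1 + g)
    {z : PhaseSpace} (hz : z ∈ levelSet d m₁ m₂ g h) (hsz : s₀ ≤ ε * z.2.1.sin)
    {T : Set PhaseSpace} (hT : T = connectedComponentIn (levelSet d m₁ m₂ g h) z)
    (hW : ∃ r : ℚ, rotationNumber d m₁ m₂ h T = r) :
    (collisionCollisionOrbits d m₁ m₂ h T).encard = 2 ∧
      ∀ O ∈ collisionCollisionOrbits d m₁ m₂ h T,
        ∃ P ∈ O, ∃ Q ∈ O, P ≠ Q ∧ P ∈ collisions d ∧ Q ∈ collisions d := by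
  have hne : ∀ x p, hamNu d m₁ m₂ h x p = g → ε * x.sin - s₀ ≠ 0 := fun x p hx h0 => by
    have := quadratic_nonneg_of_hamNu_eq hx
    rw [← sub_eq_zero.1 h0] at hneg
    rcases hε with rfl | rfl <;> linarith
  refine collisionCollisionOrbits_of_component hd hh hg
    (exists_motion_nu_libration hd hh hε hs₀ hs₁ hneg hpos)
    (f := fun x _ => ε * x.sin - s₀) ?_ (fun x p => sub_pos.symm) hne hz ?_ hT hW
  · have := Real.Angle.continuous_sin
    fun_prop
  · exact lt_of_le_of_ne hsz fun h => hne _ _ hz.2 (by rw [h, sub_self])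

end TwoCenter

open TwoCenter Set in
theorem mainTheorem5 (d m₁ m₂ : ℝ) (hd : 0 < d) (hm₁ : 0 < m₁) (hm₂ : 0 < m₂) (g h : ℝ)
    (htype : TwoCenter.IsTypeS d m₁ m₂ g h ∨ TwoCenter.IsTypeL d m₁ m₂ g h)
    (T : Set TwoCenter.PhaseSpace) (hT : TwoCenter.IsRegularTorus d m₁ m₂ g h T)
    (hW : ∃ r : ℚ, TwoCenter.rotationNumber d m₁ m₂ h T = r) :
    (TwoCenter.collisionCollisionOrbits d m₁ m₂ h T).encard = 2 ∧
      ∀ O ∈ TwoCenter.collisionCollisionOrbits d m₁ m₂ h T,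
        ∃ P ∈ O, ∃ Q ∈ O, P ≠ Q ∧ P ∈ TwoCenter.collisions d ∧ Q ∈ TwoCenter.collisions d := by
  obtain ⟨-, -, z, hz, hTz⟩ := hT
  have hd2 : 0 < d ^ 2 := by positivity
  obtain ⟨hs1, hs2⟩ := abs_le.1 (abs_sin_le_one z.2.1)
  rcases htype with ⟨hh, ⟨h1, h2⟩ | ⟨h1, h2, h3, h4⟩⟩ | ⟨hh, h1, h2, h3⟩
  · have hg : g < kappaPP d m₁ m₂ h := by
      refine h2.trans ?_
      have : |m₁ - m₂| < m₁ + m₂ := abs_lt.2 ⟨by linarith, by linarith⟩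
      have := mul_lt_mul_of_pos_left this hd
      rw [kappaMP, kappaPP]; linarith
    rw [kappaMM] at h1
    rw [kappaMP] at h2
    -- In `S'` the quadratic `-hd²s² - d(m₁ - m₂)s + g` takes the values `g - κ₋₊ < 0` and `g - κ₋₋
    -- > 0` at the two ends `s = ±1`: `ν` librates about the heavier center and the other one is
    -- forbidden.
    rcases le_or_gt 0 (m₁ - m₂) with hΔ | hΔ
    · rw [abs_of_nonneg hΔ] at h1 h2
      exact collisionCollisionOrbits_of_libration (ε := -1) (s₀ := -1) hd hh hg (by norm_num)
        le_rfl (by norm_num) (by linarith) (by linarith) hz (by linarith) hTz hW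
    · rw [abs_of_neg hΔ] at h1 h2
      exact collisionCollisionOrbits_of_libration (ε := 1) (s₀ := -1) hd hh hg (by norm_num)
        le_rfl (by norm_num) (by linarith) (by linarith) hz (by linarith) hTz hW
  · rw [kappaMP] at h2
    rw [chiM] at h3
    rw [hNu, lt_div_iff₀ (by positivity)] at h1
    have hdΔ := mul_le_mul_of_nonneg_left (le_abs_self (m₁ - m₂)) hd.le
    have hdΔ' := mul_le_mul_of_nonneg_left (neg_abs_le (m₁ - m₂)) hd.le
    have hhd : h * d < 0 := mul_neg_of_neg_of_pos hh hd
    -- `-(m₁ - m₂)/(2hd)` is the vertex of the quadratic in `s = sin ν`; `h < h_ν` puts it inside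
    -- `(-1, 1)`, and its value there is `g - χ₋ < 0`. It separates the two wells.
    have hv1 : -1 < -(m₁ - m₂) / (2 * h * d) ∧ -(m₁ - m₂) / (2 * h * d) < 1 := by
      have h5 := le_abs_self (m₁ - m₂)
      have h6 := neg_abs_le (m₁ - m₂)
      constructor
      · rw [lt_div_iff_of_neg (by linarith)]; linarith
      · rw [div_lt_iff_of_neg (by linarith)]; linarith
    have hv : ∀ ε : ℝ, ε = 1 ∨ ε = -1 → -(h * d ^ 2) * (ε * (-(m₁ - m₂) / (2 * h * d))) ^ 2
        + -(d * (m₁ - m₂) * ε) * (ε * (-(m₁ - m₂) / (2 * h * d))) + g < 0 := fun ε hε => by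
      have e : -(h * d ^ 2) * (ε * (-(m₁ - m₂) / (2 * h * d))) ^ 2
        + -(d * (m₁ - m₂) * ε) * (ε * (-(m₁ - m₂) / (2 * h * d))) + g
          = g - -(m₁ - m₂) ^ 2 / (4 * h) := by
        have := hh.ne
        rcases hε with rfl | rfl <;> field_simp <;> ring
      rw [e]; linarith
    rcases le_total (-(m₁ - m₂) / (2 * h * d)) z.2.1.sin with hle | hle
    · exact collisionCollisionOrbits_of_libration hd hh h4 (Or.inl rfl) (by linarith) (by linarith)
        (hv 1 (Or.inl rfl)) (by linarith) hz (by linarith) hTz hW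
    · exact collisionCollisionOrbits_of_libration hd hh h4 (Or.inr rfl) (by linarith) (by linarith)
        (hv (-1) (Or.inr rfl)) (by linarith) hz (by linarith) hTz hW
  -- For `h < h_ν` the minimum is the vertex value `g - χ₋ > 0`. Otherwise the vertex is not
  -- interior to `[-1, 1]`, and the minimum is the end value `g - κ₋₊ > 0`. So `p_ν` never vanishes,
  -- and its sign `σ` selects the component.
  · have hpos : ∀ s ∈ Icc (-1 : ℝ) 1, 0 < -(h * d ^ 2) * s ^ 2 + -(d * (m₁ - m₂)) * s + g := by
      intro s ⟨hs, hs'⟩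
      rw [kappaMP] at h1
      rcases lt_or_ge h (hNu d m₁ m₂) with hlt | hge
      · have h4 := h2 hlt
        rw [chiM] at h4
        have e : -(h * d ^ 2) * s ^ 2 + -(d * (m₁ - m₂)) * s + g =
            -h * (d * s + (m₁ - m₂) / (2 * h)) ^ 2 + (g - -(m₁ - m₂) ^ 2 / (4 * h)) := by
          have := hh.ne
          field_simp; ring
        rw [e]
        have : 0 < -h := by linarith
        have : 0 < g - -(m₁ - m₂) ^ 2 / (4 * h) := by linarith
        positivity
      · rw [hNu, div_le_iff₀ (by positivity)] at hge
        have hge' := mul_le_mul_of_nonneg_left hge hd.le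
        rcases le_or_gt 0 (m₁ - m₂) with hΔ | hΔ
        · rw [abs_of_nonneg hΔ] at h1 hge'
          have h5 : 0 ≤ d * (m₁ - m₂) - -(h * d ^ 2) * (1 + s) := by
            nlinarith [mul_nonneg (mul_nonneg (neg_nonneg.2 hh.le) hd2.le) (sub_nonneg.2 hs')]
          nlinarith [mul_nonneg (sub_nonneg.2 hs') h5]
        · rw [abs_of_neg hΔ] at h1 hge'
          have h5 : 0 ≤ -(d * (m₁ - m₂)) - -(h * d ^ 2) * (1 - s) := by
            nlinarith [mul_nonneg (mul_nonneg (neg_nonneg.2 hh.le) hd2.le) (neg_le_iff_add_nonneg.1 hs)]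
          nlinarith [mul_nonneg (neg_le_iff_add_nonneg.1 hs) h5]
    have hp0 : ∀ x p, hamNu d m₁ m₂ h x p = g → p ≠ 0 := by
      rintro x p hx rfl
      rw [hamNu_eq_iff] at hx
      have := hpos x.sin (abs_le.1 (abs_sin_le_one x))
      linarith
    obtain ⟨σ, hσ, hσz⟩ : ∃ σ : ℝ, (σ = 1 ∨ σ = -1) ∧ 0 < σ * z.2.2.2 := by
      rcases (hp0 _ _ hz.2).lt_or_gt with hlt | hgt
      · exact ⟨-1, Or.inr rfl, by linarith⟩
      · exact ⟨1, Or.inl rfl, by linarith⟩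
    have hσ0 : σ ≠ 0 := by rintro rfl; norm_num at hσ
    exact collisionCollisionOrbits_of_component hd hh h3 (exists_motion_nu_rotation hσ hpos)
      (f := fun _ p => σ * p) (by fun_prop) (fun _ _ => Iff.rfl)
      (fun x p hx => mul_ne_zero hσ0 (hp0 x p hx)) hz hσz hTz hW
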